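/- Let $\varepsilon>0$ and let $p>2$ be a prime. For integers $n\ge 0$ and $\alpha_1,\alpha_2,\alpha_3$, put $q:=p^n$ and let $m(\alpha_1,\alpha_2,\alpha_3;q)$ be the smallest value of $\max\{|x_1|,|x_2|,|x_3|\}$ over all $(x_1,x_2,x_3)\in\mathbb{Z}^3$ with $$\alpha_1x_1^2+\alpha_2x_2^2+\alpha_3x_3^2\equiv 0 \bmod q \quad\text{and}\quad p\nmid x_1x_2x_3;$$ if there is no such $(x_1,x_2,x_3)$, put $m(\alpha_1,\alpha_2,\alpha_3;q):=0$. Then the following hold. (i) If $\alpha_1,\alpha_2,\alpha_3$ are fixed integers with $(\alpha_1\alpha_2\alpha_3,p)=1$, then there is a constant $C>0$, depending only on $p$, $\alpha_1,\alpha_2,\alpha_3$ and $\varepsilon$, such that for all $n\ge 0$ $$m(\alpha_1,\alpha_2,\alpha_3;q)\le C\,q^{1/2+\varepsilon}.$$ (ii) There is a constant $C>0$, depending only on $p$ and $\varepsilon$, such that for all $n\ge 0$ and all integers $\alpha_1,\alpha_2,\alpha_3$ with $(\alpha_1\alpha_2\alpha_3,p)=1$ $$m(\alpha_1,\alpha_2,\alpha_3;q)\le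 C\,q^{11/18+\varepsilon}.$$ (For $n\ge1$ the left-hand side depends only on the residues of the $\alpha_i$ modulo $q$, so this bounds the maximum over all triples of residue classes modulo $q$ coprime to $p$.) -/

import Mathlib

/-- The set of heights `max {|x₁|, |x₂|, |x₃|}` of the integer solutions of
`α₁ x₁² + α₂ x₂² + α₃ x₃² ≡ 0 mod p ^ n` with `p ∤ x₁ x₂ x₃`. -/
def solutionHeights (p n : ℕ) (α₁ α₂ α₃ : ℤ) : Set ℕ :=
  {M : ℕ | ∃ x₁ x₂ x₃ : ℤ,
    α₁ * x₁ ^ 2 + α₂ * x₂ ^ 2 + α₃ * x₃ ^ 2 ≡ 0 [ZMOD (p : ℤ) ^ n] ∧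
    ¬ (p : ℤ) ∣ x₁ * x₂ * x₃ ∧
    M = max x₁.natAbs (max x₂.natAbs x₃.natAbs)}

/-- `m(α₁, α₂, α₃; p ^ n)`: the smallest height of a solution; it is `0` if there is no solution,
because the infimum of the empty set of natural numbers is `0`. -/
noncomputable def minHeight (p n : ℕ) (α₁ α₂ α₃ : ℤ) : ℕ :=
  sInf (solutionHeights p n α₁ α₂ α₃)

/-- If there is a solution, the infimum is attained by one. -/
theorem minHeight_mem {p n : ℕ} {α₁ α₂ α₃ : ℤ} (h : (solutionHeights p n α₁ α₂ α₃).Nonempty) :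
    minHeight p n α₁ α₂ α₃ ∈ solutionHeights p n α₁ α₂ α₃ :=
  Nat.sInf_mem h

/-- If there is no solution, the value is `0`. -/
theorem minHeight_eq_zero {p n : ℕ} {α₁ α₂ α₃ : ℤ} (h : solutionHeights p n α₁ α₂ α₃ = ∅) :
    minHeight p n α₁ α₂ α₃ = 0 := by
  rw [minHeight, h, Nat.sInf_empty]

/-!
If `w` solves the congruence modulo `p ^ n`, the lines tangent to the conic form a curve
`T ↦ c + 2 T m + T² l` of linear forms, where `c` is the tangent at `w`. Pairing the curve with a
vector `v` gives a polynomial in `T` whose discriminant is the quadratic form at `v`, up to a unit.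
Hence every `v` with `p ^ (2 k) ∣ c ⬝ᵥ v` and `p ^ k ∣ m ⬝ᵥ v` satisfies the congruence as soon as
`n ≤ 2 k`, and these `v` form a lattice of index at most `p ^ (3 k)`. The curve may be recentred at
any `T`, which gives many such lattices.

It remains to choose `T`, divisible by `p`, such that the lattice has no unexpectedly short vector.
This is done one `p`-adic digit at a time, for the curve and for its dual simultaneously. Two short
vectors which spoil different digits have a nonzero cross product, and that cross product is
`p ^ k` times a vector of the dual lattice, which would be too short. Hence at most one digit is
bad for the curve and at most one for its dual, and since `p ≥ 3` a good digit is left.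

A lattice with no short vectors, whose dual has none either, is generated by vectors of size
`O(p ^ k)`. One of them pairs with `l` to something prime to `p`, and then, being congruent to a
multiple of `w`, has all its coordinates prime to `p`.
-/

open Matrix

section LatticePoints

variable {ι : Type*} [Fintype ι]

theorem exists_finset_mem_norm_le (L : AddSubgroup (ι → ℤ)) [L.FiniteIndex] {m B : ℕ}
    (h : L.index * m < (B + 1) ^ Fintype.card ι) :
    ∃ S : Finset (ι → ℤ), m < S.card ∧ ∀ v ∈ S, v ∈ L ∧ ‖v‖ ≤ B := by
  classical
  have := Fintype.ofFinite ((ι → ℤ) ⧸ L)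
  set box : Finset (ι → ℤ) := Fintype.piFinset fun _ => Finset.Icc 0 (B : ℤ)
  have hbox : box.card = (B + 1) ^ Fintype.card ι := by
    simp [box, Fintype.card_piFinset]
  obtain ⟨y, -, hy⟩ := Finset.exists_lt_card_fiber_of_mul_lt_card_of_maps_to
    (s := box) (t := Finset.univ) (f := fun v => (v : (ι → ℤ) ⧸ L)) (n := m)
    (fun _ _ => Finset.mem_univ _)
    (by rwa [Finset.card_univ, ← Nat.card_eq_fintype_card, hbox])
  obtain ⟨b, hb⟩ := Finset.card_pos.1 (Nat.zero_lt_of_lt hy)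
  refine ⟨(box.filter fun x : ι → ℤ => (x : (ι → ℤ) ⧸ L) = y).image (· - b), ?_, fun v hv => ?_⟩
  · rwa [Finset.card_image_of_injective _ sub_left_injective]
  obtain ⟨x, hx, rfl⟩ := Finset.mem_image.1 hv
  rw [Finset.mem_filter, Fintype.mem_piFinset] at hx hb
  refine ⟨?_, (pi_norm_le_iff_of_nonneg B.cast_nonneg).2 fun i => ?_⟩
  · rw [sub_eq_neg_add]
    exact QuotientAddGroup.eq.1 (hb.2.trans hx.2.symm)
  · have hxi := Finset.mem_Icc.1 (hx.1 i)
    have hbi := Finset.mem_Icc.1 (hb.1 i)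
    rw [Pi.sub_apply, Int.norm_eq_abs]
    exact_mod_cast abs_sub_le_of_nonneg_of_le hxi.1 hxi.2 hbi.1 hbi.2

theorem card_le_prod_of_le_mul_norm_sub {α : Type*} {S : Finset α} {f : α → ι → ℤ} {K : ℕ}
    {M : ι → ℝ} {c : ι → ℕ} (hM : ∀ i, 0 < M i) (hf : ∀ u ∈ S, ∀ i, ‖f u i‖ ≤ c i * M i)
    (hsep : ∀ u ∈ S, ∀ v ∈ S, u ≠ v → ∃ i, M i ≤ K * ‖f u i - f v i‖) :
    S.card ≤ ∏ i, (2 * (K * c i) + 1) := by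
  classical
  set x : α → ι → ℝ := fun u i => K * f u i / M i
  set cells : Finset (ι → ℤ) := Fintype.piFinset fun i => Finset.Icc (-(K * c i) : ℤ) (K * c i)
  have hmaps : Set.MapsTo (fun u i => ⌊x u i⌋) S cells := fun u hu => by
    refine Finset.mem_coe.2 (Fintype.mem_piFinset.2 fun i => Finset.mem_Icc.2 ?_)
    have hx : |x u i| ≤ K * c i := by
      rw [abs_div, abs_mul, Nat.abs_cast, abs_of_pos (hM i), ← Int.norm_eq_abs,
        div_le_iff₀ (hM i), mul_assoc]
      exact mul_le_mul_of_nonneg_left (hf u hu i) K.cast_nonneg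
    obtain ⟨hlo, hhi⟩ := abs_le.1 hx
    exact ⟨Int.le_floor.2 (by exact_mod_cast hlo), by exact_mod_cast (Int.floor_le _).trans hhi⟩
  have hinj : Set.InjOn (fun u i => ⌊x u i⌋) S := fun u hu v hv huv => by
    by_contra hne
    obtain ⟨i, hi⟩ := hsep u hu v hv hne
    refine (Int.abs_sub_lt_one_of_floor_eq_floor (congrFun huv i)).not_ge ?_
    rwa [← sub_div, ← mul_sub, abs_div, abs_mul, Nat.abs_cast, abs_of_pos (hM i), ← Int.cast_sub,
      ← Int.norm_eq_abs, one_le_div (hM i)]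
  refine (Finset.card_le_card_of_injOn _ hmaps hinj).trans_eq ?_
  rw [Fintype.card_piFinset]
  refine Finset.prod_congr rfl fun i _ => ?_
  rw [Int.card_Icc]
  lia

variable [DecidableEq ι]

/- Cramer's rule, with the fractional parts of the coordinates of `v` in the basis of the rows. -/
theorem exists_norm_sub_vecMul_le {A : Matrix ι ι ℤ} (hA : A.det ≠ 0) {H : ℝ}
    (hH : ∀ i, ‖A i‖ ≤ H) (v : ι → ℤ) :
    ∃ m : ι → ℤ, ‖v - m ᵥ* A‖ ≤ Fintype.card ι * H := by
  set D := A.det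
  set x := v ᵥ* A.adjugate
  have hx : x ᵥ* A = D • v := by
    rw [vecMul_vecMul, adjugate_mul, vecMul_smul, vecMul_one]
  have hfrac : D • (v - (fun i => x i / D) ᵥ* A) = (fun i => x i % D) ᵥ* A := by
    rw [smul_sub, ← hx, ← smul_vecMul, ← sub_vecMul]
    congr 1
    ext i
    simp only [Pi.sub_apply, Pi.smul_apply, smul_eq_mul, Int.emod_def]
  have hrem : ∀ i, ‖x i % D‖ ≤ ‖D‖ := fun i => by
    rw [Int.norm_eq_abs, Int.norm_eq_abs]
    exact_mod_cast (abs_of_nonneg (Int.emod_nonneg _ hA)).le.trans (Int.emod_lt_abs _ hA).le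
  refine ⟨fun i => x i / D, le_of_mul_le_mul_left ?_ (norm_pos_iff.2 hA)⟩
  rw [← norm_smul, hfrac, vecMul_eq_sum]
  calc ‖∑ i, (x i % D) • A i‖ ≤ ∑ i, ‖(x i % D) • A i‖ := norm_sum_le _ _
    _ ≤ ∑ _i : ι, ‖D‖ * H := Finset.sum_le_sum fun i _ => by
        rw [norm_smul]
        exact mul_le_mul (hrem i) (hH i) (norm_nonneg _) (norm_nonneg _)
    _ = ‖D‖ * (Fintype.card ι * H) := by
        rw [Finset.sum_const, Finset.card_univ, nsmul_eq_mul]; ring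

theorem le_closure_norm_le {L : AddSubgroup (ι → ℤ)} {A : Matrix ι ι ℤ} (hA : A.det ≠ 0) {H : ℝ}
    (hL : ∀ i, A i ∈ L) (hH : ∀ i, ‖A i‖ ≤ H) :
    L ≤ AddSubgroup.closure {v | v ∈ L ∧ ‖v‖ ≤ Fintype.card ι * H} := by
  intro v hv
  obtain ⟨m, hm⟩ := exists_norm_sub_vecMul_le hA hH v
  have hrows : ∀ i, A i ∈ AddSubgroup.closure {v | v ∈ L ∧ ‖v‖ ≤ Fintype.card ι * H} := fun i => by
    have : Nonempty ι := ⟨i⟩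
    refine AddSubgroup.subset_closure ⟨hL i, (hH i).trans ?_⟩
    exact le_mul_of_one_le_left ((norm_nonneg _).trans (hH i))
      (by exact_mod_cast Fintype.card_pos)
  have hmem : ∀ L' : AddSubgroup (ι → ℤ), (∀ i, A i ∈ L') → m ᵥ* A ∈ L' := fun L' hL' => by
    rw [vecMul_eq_sum]
    exact sum_mem fun i _ => zsmul_mem (hL' i) (m i)
  rw [← sub_add_cancel v (m ᵥ* A)]
  exact add_mem (AddSubgroup.subset_closure ⟨sub_mem hv (hmem L hL), hm⟩) (hmem _ hrows)

end LatticePoints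

section CrossProduct

variable {R : Type*}

theorem mul_comm_of_cross_eq_zero [CommRing R] {v w : Fin 3 → R} (h : v ⨯₃ w = 0) (i j : Fin 3) :
    v i * w j = v j * w i := by
  simp only [cross_apply, cons_eq_zero_iff, sub_eq_zero] at h
  obtain ⟨h₁₂, h₂₀, h₀₁, -⟩ := h
  fin_cases i <;> fin_cases j <;> simp [*]

theorem cross_cross_cross_eq_smul [CommRing R] (a u w : Fin 3 → R) :
    (a ⨯₃ u) ⨯₃ (a ⨯₃ w) = (a ⬝ᵥ u ⨯₃ w) • a := by
  rw [cross_cross_eq_smul_sub_smul', dot_self_cross, zero_smul, sub_zero, dotProduct_comm,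
    triple_product_permutation]

theorem exists_norm_apply_eq {ι E : Type*} [Fintype ι] [Nonempty ι] [SeminormedAddGroup E]
    (w : ι → E) : ∃ i, ‖w i‖ = ‖w‖ := by
  obtain ⟨i, hi⟩ := Finite.exists_max fun i => ‖w i‖
  exact ⟨i, (norm_le_pi_norm w i).antisymm ((pi_norm_le_iff_of_nonneg (norm_nonneg _)).2 hi)⟩

variable [NormedCommRing R]

theorem norm_cross_le (v w : Fin 3 → R) : ‖v ⨯₃ w‖ ≤ 2 * ‖v‖ * ‖w‖ := by
  have hmul (i j : Fin 3) : ‖v i * w j‖ ≤ ‖v‖ * ‖w‖ :=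
    norm_mul_le_of_le (norm_le_pi_norm v i) (norm_le_pi_norm w j)
  have hsub (i j : Fin 3) : ‖v i * w j - v j * w i‖ ≤ 2 * ‖v‖ * ‖w‖ :=
    (norm_sub_le _ _).trans (by linarith [hmul i j, hmul j i])
  refine (pi_norm_le_iff_of_nonneg (by positivity)).2 fun i => ?_
  fin_cases i <;> simp only [cross_apply] <;> exact hsub _ _

variable [NormMulClass R]

theorem norm_apply_eq_of_cross_eq_zero {v w : Fin 3 → R} (h : v ⨯₃ w = 0) (hw : w ≠ 0) {i : Fin 3}
    (hi : ‖w i‖ = ‖w‖) : ‖v i‖ = ‖v‖ := by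
  refine (norm_le_pi_norm v i).antisymm ((pi_norm_le_iff_of_nonneg (norm_nonneg _)).2 fun j => ?_)
  refine le_of_mul_le_mul_right ?_ (norm_pos_iff.2 hw)
  calc ‖v j‖ * ‖w‖ = ‖v i‖ * ‖w j‖ := by
        rw [← hi, ← norm_mul, mul_comm_of_cross_eq_zero h j i, norm_mul]
    _ ≤ ‖v i‖ * ‖w‖ := by gcongr; exact norm_le_pi_norm w j

theorem exists_forall_norm_apply_eq {T : Set (Fin 3 → R)}
    (hT : ∀ u ∈ T, ∀ w ∈ T, u ⨯₃ w = 0) : ∃ i, ∀ u ∈ T, ‖u i‖ = ‖u‖ := by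
  by_cases hzero : ∀ u ∈ T, u = 0
  · exact ⟨0, fun u hu => by simp [hzero u hu]⟩
  push Not at hzero
  obtain ⟨w, hw, hw0⟩ := hzero
  obtain ⟨i, hi⟩ := exists_norm_apply_eq w
  exact ⟨i, fun u hu => norm_apply_eq_of_cross_eq_zero (hT u hu w hw) hw0 hi⟩

end CrossProduct

/- The products `a ⨯₃ u` of short `u` are parallel, so that `v` is determined by one coordinate of
`a ⨯₃ v` together with one coordinate of `v`. -/
theorem card_le_of_coplanar {L : AddSubgroup (Fin 3 → ℤ)} {N K c : ℕ} (hN : 0 < N)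
    (hvec : ∀ v ∈ L, v ≠ 0 → N ≤ K * ‖v‖)
    (hcross : ∀ v ∈ L, ∀ w ∈ L, v ⨯₃ w ≠ 0 → N ^ 2 ≤ K * ‖v ⨯₃ w‖)
    {a : Fin 3 → ℤ} (haL : a ∈ L) (ha0 : a ≠ 0) (ha : ‖a‖ ≤ N)
    (hcop : ∀ u ∈ L, ‖u‖ ≤ 2 * c * N → ∀ w ∈ L, ‖w‖ ≤ 2 * c * N → a ⬝ᵥ u ⨯₃ w = 0)
    {S : Finset (Fin 3 → ℤ)} (hS : ∀ v ∈ S, v ∈ L ∧ ‖v‖ ≤ c * N) :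
    S.card ≤ (4 * K * c + 1) * (2 * K * c + 1) := by
  have hNr : (0 : ℝ) < N := by exact_mod_cast hN
  obtain ⟨j, hj⟩ := exists_norm_apply_eq a
  obtain ⟨i, hi⟩ : ∃ i, ∀ u ∈ (a ⨯₃ ·) '' {w | w ∈ L ∧ ‖w‖ ≤ 2 * c * N}, ‖u i‖ = ‖u‖ := by
    refine exists_forall_norm_apply_eq ?_
    rintro _ ⟨u, hu, rfl⟩ _ ⟨w, hw, rfl⟩
    rw [cross_cross_cross_eq_smul, hcop u hu.1 hu.2 w hw.1 hw.2, zero_smul]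
  refine (card_le_prod_of_le_mul_norm_sub (f := fun v => ![(a ⨯₃ v) i, v j]) (K := K)
    (M := ![(N : ℝ) ^ 2, N]) (c := ![2 * c, c]) (Fin.forall_fin_two.2 ⟨pow_pos hNr 2, hNr⟩)
    (fun v hv => Fin.forall_fin_two.2 ⟨?_, ?_⟩) fun u hu v hv huv => ?_).trans_eq ?_
  · calc ‖(a ⨯₃ v) i‖ ≤ 2 * ‖a‖ * ‖v‖ := (norm_le_pi_norm _ i).trans (norm_cross_le a v)
      _ ≤ 2 * N * (c * N) := by gcongr; exact (hS v hv).2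
      _ = (2 * c : ℕ) * (N : ℝ) ^ 2 := by push_cast; ring
  · exact (norm_le_pi_norm v j).trans (hS v hv).2
  · have hdL : u - v ∈ L := sub_mem (hS u hu).1 (hS v hv).1
    have hd : ‖u - v‖ ≤ 2 * c * N :=
      (norm_sub_le u v).trans (by linarith [(hS u hu).2, (hS v hv).2])
    rw [Fin.exists_fin_two]
    by_cases hpar : a ⨯₃ (u - v) = 0
    · right
      have hnorm : ‖(u - v) j‖ = ‖u - v‖ := by
        refine norm_apply_eq_of_cross_eq_zero ?_ ha0 hj
        rw [← cross_anticomm, hpar, neg_zero]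
      exact (hvec _ hdL (sub_ne_zero.2 huv)).trans_eq (by rw [← hnorm]; rfl)
    · left
      have hnorm : ‖(a ⨯₃ (u - v)) i‖ = ‖a ⨯₃ (u - v)‖ := hi _ ⟨_, ⟨hdL, hd⟩, rfl⟩
      exact (hcross a haL _ hdL hpar).trans_eq (by rw [← hnorm, map_sub]; rfl)
  · rw [Fin.prod_univ_two]
    simp only [cons_val]
    ring

theorem exists_det_ne_zero_norm_le {L : AddSubgroup (Fin 3 → ℤ)} [L.FiniteIndex] {N K : ℕ}
    (hN : 0 < N) (hindex : L.index ≤ N ^ 3)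
    (hvec : ∀ v ∈ L, v ≠ 0 → N ≤ K * ‖v‖)
    (hcross : ∀ v ∈ L, ∀ w ∈ L, v ⨯₃ w ≠ 0 → N ^ 2 ≤ K * ‖v ⨯₃ w‖) :
    ∃ A : Matrix (Fin 3) (Fin 3) ℤ, A.det ≠ 0 ∧ ∀ i, A i ∈ L ∧ ‖A i‖ ≤ 30 * K ^ 2 * N := by
  have hmany (c : ℕ) :
      ∃ S : Finset (Fin 3 → ℤ), c ^ 3 < S.card ∧ ∀ v ∈ S, v ∈ L ∧ ‖v‖ ≤ c * N := by
    have hlt : L.index * c ^ 3 < (c * N + 1) ^ Fintype.card (Fin 3) :=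
      calc L.index * c ^ 3 ≤ N ^ 3 * c ^ 3 := by gcongr
        _ = (c * N) ^ 3 := by ring
        _ < (c * N + 1) ^ 3 := by gcongr; lia
    exact_mod_cast exists_finset_mem_norm_le L hlt
  obtain ⟨S₁, hcard₁, hS₁⟩ := hmany 1
  rw [one_pow] at hcard₁
  obtain ⟨a, haS, ha0⟩ := Finset.exists_mem_ne hcard₁ 0
  obtain ⟨haL, ha⟩ := hS₁ a haS
  rw [Nat.cast_one, one_mul] at ha
  have hK : 1 ≤ K := by
    by_contra! hK
    have := hvec a haL ha0
    rw [Nat.lt_one_iff.1 hK, Nat.cast_zero, zero_mul] at this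
    exact this.not_gt (by exact_mod_cast hN)
  set c := 15 * K ^ 2 with hc
  obtain ⟨S, hcard, hS⟩ := hmany c
  suffices ∃ u ∈ L, ‖u‖ ≤ 2 * c * N ∧ ∃ w ∈ L, ‖w‖ ≤ 2 * c * N ∧ a ⬝ᵥ u ⨯₃ w ≠ 0 by
    obtain ⟨u, huL, hu, w, hwL, hw, hne⟩ := this
    have hc' : (2 * c : ℝ) = 30 * K ^ 2 := by rw [hc]; push_cast; ring
    have haN : (N : ℝ) ≤ 30 * K ^ 2 * N :=
      le_mul_of_one_le_left N.cast_nonneg (by exact_mod_cast (by nlinarith : 1 ≤ 30 * K ^ 2))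
    rw [hc'] at hu hw
    refine ⟨![a, u, w], by rwa [← triple_product_eq_det], fun i => ?_⟩
    fin_cases i
    exacts [⟨haL, ha.trans haN⟩, ⟨huL, hu⟩, ⟨hwL, hw⟩]
  by_contra! hcop
  refine hcard.not_ge ((card_le_of_coplanar hN hvec hcross haL ha0 ha hcop hS).trans ?_)
  have hKc : 1 ≤ K * c := Nat.mul_pos hK (by positivity)
  calc (4 * K * c + 1) * (2 * K * c + 1) ≤ (5 * (K * c)) * (3 * (K * c)) := by
        gcongr <;> lia
    _ = c ^ 3 := by rw [hc]; ring

theorem exists_and_of_dvd_sub {p : ℕ} (hp : 2 < p) {P Q : ℤ → Prop}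
    (hP : ∀ s s', ¬ P s → ¬ P s' → (p : ℤ) ∣ s - s')
    (hQ : ∀ s s', ¬ Q s → ¬ Q s' → (p : ℤ) ∣ s - s') : ∃ s, P s ∧ Q s := by
  have hor {R : ℤ → Prop} (hR : ∀ s s', ¬ R s → ¬ R s' → (p : ℤ) ∣ s - s') {i j : ℤ}
      (hlt : 0 < i - j) (hle : i - j ≤ 2) : R i ∨ R j := by
    by_contra! hne
    have := Int.le_of_dvd hlt (hR i j hne.1 hne.2)
    lia
  have hP₁₀ : P 1 ∨ P 0 := hor hP (by decide) (by decide)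
  have hP₂₀ : P 2 ∨ P 0 := hor hP (by decide) (by decide)
  have hP₂₁ : P 2 ∨ P 1 := hor hP (by decide) (by decide)
  have hQ₁₀ : Q 1 ∨ Q 0 := hor hQ (by decide) (by decide)
  have hQ₂₀ : Q 2 ∨ Q 0 := hor hQ (by decide) (by decide)
  have hQ₂₁ : Q 2 ∨ Q 1 := hor hQ (by decide) (by decide)
  grind

/-- A quadratically parametrised curve `T ↦ const + 2 T mid + T² lead` of linear forms on `ℤ³`,
given by their coefficient vectors. It serves as the conic of lines tangent to a conic. -/
structure QuadCurve where
  lead : Fin 3 → ℤ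
  mid : Fin 3 → ℤ
  const : Fin 3 → ℤ

namespace QuadCurve

/-- The reparametrisation `T ↦ T + s`, which moves the point at `s` to `T = 0`. -/
def shift (F : QuadCurve) (s : ℤ) : QuadCurve where
  lead := F.lead
  mid := F.mid + s • F.lead
  const := F.const + (2 * s) • F.mid + s ^ 2 • F.lead

/-- The dual conic: its point at `T` is the cross product of the derivative of the curve at `T` and
the point of the curve at `T`. -/
def dual (F : QuadCurve) : QuadCurve where
  lead := (2 : ℤ) • F.lead ⨯₃ F.mid
  mid := F.lead ⨯₃ F.const
  const := (2 : ℤ) • F.mid ⨯₃ F.const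

/-- The determinant of the coefficient vectors `lead`, `2 mid` and `const` of the curve. -/
def det (F : QuadCurve) : ℤ := 2 * (F.lead ⬝ᵥ F.mid ⨯₃ F.const)

/-- A quarter of the discriminant in `T` of the pairing of the curve with `v`. It is the quadratic
form whose tangent lines the curve parametrises. -/
def form (F : QuadCurve) (v : Fin 3 → ℤ) : ℤ := (F.mid ⬝ᵥ v) ^ 2 - F.lead ⬝ᵥ v * F.const ⬝ᵥ v

/-- The vectors `v` whose pairing with the curve, as a polynomial in `T`, has constant coefficient
divisible by `p ^ (2 k)` and half its linear coefficient divisible by `p ^ k`. These `v` are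
`p`-adically near the point of contact of the tangent at `T = 0`. -/
def lattice (F : QuadCurve) (p k : ℕ) : AddSubgroup (Fin 3 → ℤ) :=
  (AddSubgroup.zmultiples ((p : ℤ) ^ (2 * k))).comap (dotProductBilin ℤ ℤ F.const).toAddMonoidHom ⊓
    (AddSubgroup.zmultiples ((p : ℤ) ^ k)).comap (dotProductBilin ℤ ℤ F.mid).toAddMonoidHom

/-- No nonzero lattice vector is shorter than `p ^ k / (2 p ²)`. The constant makes two lattice
vectors of level `k + 1` that violate it have a cross product too short at level `k`: its norm is at
most twice the product of theirs, and passing to the dual lattice divides it by `p ^ k`. -/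
def Separated (F : QuadCurve) (p k : ℕ) : Prop :=
  ∀ v ∈ F.lattice p k, v ≠ 0 → (p : ℝ) ^ k ≤ 2 * p ^ 2 * ‖v‖

variable {F : QuadCurve} {p k : ℕ} {s : ℤ} {v w : Fin 3 → ℤ}

theorem mem_lattice :
    v ∈ F.lattice p k ↔ (p : ℤ) ^ (2 * k) ∣ F.const ⬝ᵥ v ∧ (p : ℤ) ^ k ∣ F.mid ⬝ᵥ v := by
  simp [lattice, AddSubgroup.mem_inf, Int.mem_zmultiples_iff]

theorem shift_shift (F : QuadCurve) (s t : ℤ) : (F.shift s).shift t = F.shift (s + t) := by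
  simp only [shift, mk.injEq, true_and]
  constructor <;> module

theorem det_shift (F : QuadCurve) (s : ℤ) : (F.shift s).det = F.det := by
  simp only [det, shift, map_add, map_smul, LinearMap.add_apply, LinearMap.smul_apply, cross_self,
    dotProduct_add, dotProduct_smul, dot_self_cross, dot_cross_self, smul_zero, add_zero, zero_add]

theorem form_shift (F : QuadCurve) (s : ℤ) (v : Fin 3 → ℤ) : (F.shift s).form v = F.form v := by
  simp only [form, shift, add_dotProduct, smul_dotProduct, smul_eq_mul]
  ring

theorem dual_shift (F : QuadCurve) (s : ℤ) : (F.shift s).dual = F.dual.shift s := by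
  simp only [dual, shift, map_add, map_smul, LinearMap.add_apply, LinearMap.smul_apply, cross_self,
    mk.injEq]
  rw [← cross_anticomm F.lead F.mid]
  refine ⟨?_, ?_, ?_⟩ <;> module

theorem det_dual (F : QuadCurve) : F.dual.det = 2 * F.det ^ 2 := by
  have hcross : (F.lead ⨯₃ F.const) ⨯₃ (F.mid ⨯₃ F.const) =
      (F.const ⬝ᵥ F.lead ⨯₃ F.mid) • F.const := by
    rw [← cross_anticomm F.const F.lead, ← cross_anticomm F.const F.mid, map_neg, map_neg,
      LinearMap.neg_apply, neg_neg, cross_cross_cross_eq_smul]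
  simp only [det, dual, map_smul, hcross, dotProduct_smul, smul_eq_mul,
    dotProduct_comm _ F.const, ← triple_product_permutation F.const]
  ring

theorem pow_dvd_form (hv : v ∈ F.lattice p k) : (p : ℤ) ^ (2 * k) ∣ F.form v := by
  obtain ⟨hconst, hmid⟩ := mem_lattice.1 hv
  refine dvd_sub ?_ (hconst.mul_left _)
  rw [mul_comm, pow_mul]
  exact pow_dvd_pow_of_dvd hmid 2

theorem lattice_shift_le (hs : (p : ℤ) ^ k ∣ s) {j : ℕ} (hkj : k ≤ j) :
    (F.shift s).lattice p j ≤ F.lattice p k := by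
  intro v hv
  simp only [mem_lattice, shift, add_dotProduct, smul_dotProduct, smul_eq_mul] at hv ⊢
  have hmid : (p : ℤ) ^ k ∣ F.mid ⬝ᵥ v :=
    (dvd_add_left (hs.mul_right _)).1 ((pow_dvd_pow _ hkj).trans hv.2)
  have hsq : (p : ℤ) ^ (2 * k) ∣ s ^ 2 := by
    rw [mul_comm, pow_mul]
    exact pow_dvd_pow_of_dvd hs 2
  have hlin : (p : ℤ) ^ (2 * k) ∣ 2 * s * (F.mid ⬝ᵥ v) := by
    rw [two_mul k, pow_add]
    exact mul_dvd_mul (hs.mul_left 2) hmid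
  have hconst := (pow_dvd_pow (p : ℤ) (Nat.mul_le_mul_left 2 hkj)).trans hv.1
  rw [add_assoc, dvd_add_left (hlin.add (hsq.mul_right _))] at hconst
  exact ⟨hconst, hmid⟩

theorem index_lattice_ne_zero_and_le (F : QuadCurve) (hp : p ≠ 0) (k : ℕ) :
    (F.lattice p k).index ≠ 0 ∧ (F.lattice p k).index ≤ (p ^ k) ^ 3 := by
  have hcomap (f : (Fin 3 → ℤ) →+ ℤ) (j : ℕ) :
      ((AddSubgroup.zmultiples ((p : ℤ) ^ j)).comap f).index ∣ p ^ j := by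
    rw [AddSubgroup.index_comap]
    refine (AddSubgroup.relIndex_dvd_index_of_normal _ _).trans (dvd_of_eq ?_)
    rw [Int.index_zmultiples, Int.natAbs_pow, Int.natAbs_natCast]
  have hne (f : (Fin 3 → ℤ) →+ ℤ) (j : ℕ) := ne_zero_of_dvd_ne_zero (pow_ne_zero j hp) (hcomap f j)
  have hle (f : (Fin 3 → ℤ) →+ ℤ) (j : ℕ) := Nat.le_of_dvd (by positivity) (hcomap f j)
  refine ⟨AddSubgroup.index_inf_ne_zero (hne _ _) (hne _ _), ?_⟩
  exact AddSubgroup.index_inf_le.trans ((Nat.mul_le_mul (hle _ _) (hle _ _)).trans_eq (by ring))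

theorem det_smul (F : QuadCurve) (v : Fin 3 → ℤ) :
    F.det • v = (2 : ℤ) • ((F.lead ⬝ᵥ v) • F.mid ⨯₃ F.const - (F.mid ⬝ᵥ v) • F.lead ⨯₃ F.const +
      (F.const ⬝ᵥ v) • F.lead ⨯₃ F.mid) := by
  simp_rw [det, cross_apply, vec3_dotProduct]
  ext i
  fin_cases i <;>
    simp only [Fin.isValue, Fin.zero_eta, Fin.mk_one, Fin.reduceFinMk, cons_val, Pi.smul_apply,
      Pi.add_apply, Pi.sub_apply, smul_eq_mul] <;>
    ring

theorem dual_dual (F : QuadCurve) :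
    F.dual.dual =
      ⟨(2 * F.det) • F.lead, (2 * F.det) • F.mid, (2 * F.det) • F.const⟩ := by
  simp_rw [dual, det, cross_apply, vec3_dotProduct]
  congr 1 <;> ext i <;> fin_cases i <;>
    simp only [Fin.isValue, Fin.zero_eta, Fin.mk_one, Fin.reduceFinMk, cons_val, Pi.smul_apply,
      smul_eq_mul] <;>
    ring

theorem exists_eq_smul_of_dvd_dotProduct {q : ℤ} (hdet : IsCoprime q F.det)
    (hlead : q ∣ F.lead ⬝ᵥ v) (hmid : q ∣ F.mid ⬝ᵥ v) (hconst : q ∣ F.const ⬝ᵥ v) :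
    ∃ u, v = q • u := by
  have hdvd : ∀ i, q ∣ v i := fun i => by
    refine hdet.dvd_of_dvd_mul_left ?_
    have := congrFun (F.det_smul v) i
    simp only [Pi.smul_apply, Pi.add_apply, Pi.sub_apply, smul_eq_mul] at this
    rw [this]
    exact (((hlead.mul_right _).sub (hmid.mul_right _)).add (hconst.mul_right _)).mul_left 2
  choose u hu using hdvd
  exact ⟨u, funext hu⟩

theorem isCoprime_two (h : IsCoprime (p : ℤ) F.det) : IsCoprime (p : ℤ) 2 := h.of_mul_right_left

theorem isCoprime_det_dual (h : IsCoprime (p : ℤ) F.det) : IsCoprime (p : ℤ) F.dual.det := by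
  rw [det_dual]
  exact (isCoprime_two h).mul_right h.pow_right

theorem lattice_dual_dual (hdet : IsCoprime (p : ℤ) F.det) :
    F.dual.dual.lattice p k = F.lattice p k := by
  have hcop (j : ℕ) : IsCoprime ((p : ℤ) ^ j) (2 * F.det) :=
    ((isCoprime_two hdet).mul_right hdet).pow_left
  have hdvd (j : ℕ) (x : ℤ) : (p : ℤ) ^ j ∣ 2 * F.det * x ↔ (p : ℤ) ^ j ∣ x :=
    ⟨(hcop j).dvd_of_dvd_mul_left, fun h => h.mul_left _⟩
  ext v
  simp only [mem_lattice, dual_dual, smul_dotProduct, smul_eq_mul, hdvd]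

theorem exists_cross_eq_smul (hdet : IsCoprime (p : ℤ) F.det) (hp : p ≠ 0) (hv : v ∈ F.lattice p k)
    (hw : w ∈ F.lattice p k) : ∃ u ∈ F.dual.lattice p k, v ⨯₃ w = (p : ℤ) ^ k • u := by
  have hpk : (p : ℤ) ^ k ≠ 0 := pow_ne_zero _ (by exact_mod_cast hp)
  rw [mem_lattice] at hv hw
  have hlead : (p : ℤ) ^ k ∣ F.dual.lead ⬝ᵥ v ⨯₃ w := by
    rw [dual, smul_dotProduct, cross_dot_cross, smul_eq_mul]
    exact ((hw.2.mul_left _).sub (hv.2.mul_left _)).mul_left _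
  have hmid : (p : ℤ) ^ k * p ^ k ∣ F.dual.mid ⬝ᵥ v ⨯₃ w := by
    rw [dual, cross_dot_cross, ← pow_add, ← two_mul]
    exact (hw.1.mul_left _).sub (hv.1.mul_left _)
  have hconst : (p : ℤ) ^ k * p ^ (2 * k) ∣ F.dual.const ⬝ᵥ v ⨯₃ w := by
    rw [dual, smul_dotProduct, cross_dot_cross, smul_eq_mul]
    refine dvd_mul_of_dvd_right (dvd_sub (mul_dvd_mul hv.2 hw.1) ?_) _
    exact mul_dvd_mul hw.2 hv.1
  obtain ⟨u, hu⟩ := exists_eq_smul_of_dvd_dotProduct (isCoprime_det_dual hdet).pow_left hlead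
    ((dvd_mul_right _ _).trans hmid) ((dvd_mul_right _ _).trans hconst)
  rw [hu, dotProduct_smul, smul_eq_mul, mul_dvd_mul_iff_left hpk] at hmid hconst
  exact ⟨u, mem_lattice.2 ⟨hconst, hmid⟩, hu⟩

theorem exists_eq_smul_of_dvd_lead (hdet : IsCoprime (p : ℤ) F.det) (hp : p ≠ 0)
    (hv : v ∈ F.lattice p (k + 1)) (hlead : (p : ℤ) ∣ F.lead ⬝ᵥ v) :
    ∃ u ∈ F.lattice p k, v = (p : ℤ) • u := by
  obtain ⟨hconst, hmid⟩ := mem_lattice.1 hv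
  have hp0 : (p : ℤ) ≠ 0 := by exact_mod_cast hp
  obtain ⟨u, rfl⟩ := exists_eq_smul_of_dvd_dotProduct hdet hlead
    ((dvd_pow_self _ k.succ_ne_zero).trans hmid) ((dvd_pow_self _ (by lia)).trans hconst)
  rw [dotProduct_smul, smul_eq_mul] at hconst hmid
  rw [pow_succ', mul_dvd_mul_iff_left hp0] at hmid
  refine ⟨u, mem_lattice.2 ⟨?_, hmid⟩, rfl⟩
  rw [Nat.mul_succ, pow_succ', mul_dvd_mul_iff_left hp0, pow_succ] at hconst
  exact (dvd_mul_right _ _).trans hconst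

theorem Separated.shift (h : F.Separated p k) (hs : (p : ℤ) ^ k ∣ s) :
    (F.shift s).Separated p k :=
  fun v hv => h v (lattice_shift_le hs le_rfl hv)

theorem Separated.dual_dual (h : F.Separated p k) (hdet : IsCoprime (p : ℤ) F.det) :
    F.dual.dual.Separated p k := by
  rwa [Separated, lattice_dual_dual hdet]

theorem separated_one (F : QuadCurve) (hp : p ≠ 0) : F.Separated p 1 := by
  intro v _ hv0
  obtain ⟨i, hi⟩ := Function.ne_iff.1 hv0
  have hvi : 1 ≤ ‖v i‖ := by
    rw [Int.norm_eq_abs]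
    exact_mod_cast Int.one_le_abs hi
  have hv : 1 ≤ ‖v‖ := hvi.trans (norm_le_pi_norm v i)
  have hp1 : (1 : ℝ) ≤ p := by exact_mod_cast Nat.one_le_iff_ne_zero.2 hp
  nlinarith

theorem Separated.sq_le_norm_cross (h : F.dual.Separated p k) (hdet : IsCoprime (p : ℤ) F.det)
    (hp : p ≠ 0) (hv : v ∈ F.lattice p k) (hw : w ∈ F.lattice p k) (hvw : v ⨯₃ w ≠ 0) :
    ((p : ℝ) ^ k) ^ 2 ≤ 2 * p ^ 2 * ‖v ⨯₃ w‖ := by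
  obtain ⟨u, hu, huv⟩ := exists_cross_eq_smul hdet hp hv hw
  have hu0 : u ≠ 0 := by
    rintro rfl
    exact hvw (by rw [huv, smul_zero])
  calc ((p : ℝ) ^ k) ^ 2 = p ^ k * p ^ k := sq _
    _ ≤ p ^ k * (2 * p ^ 2 * ‖u‖) := by gcongr; exact h u hu hu0
    _ = 2 * p ^ 2 * ‖v ⨯₃ w‖ := by
        rw [huv, norm_smul, norm_pow, Int.norm_natCast]; ring

theorem Separated.not_dvd_lead (h : F.Separated p k) (hdet : IsCoprime (p : ℤ) F.det) (hp : p ≠ 0)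
    (hv : v ∈ F.lattice p (k + 1)) (hv0 : v ≠ 0) (hlt : 2 * p ^ 2 * ‖v‖ < (p : ℝ) ^ (k + 1)) :
    ¬ (p : ℤ) ∣ F.lead ⬝ᵥ v := by
  intro hlead
  obtain ⟨u, hu, rfl⟩ := exists_eq_smul_of_dvd_lead hdet hp hv hlead
  refine hlt.not_ge ?_
  calc (p : ℝ) ^ (k + 1) = p * p ^ k := pow_succ' _ _
    _ ≤ p * (2 * p ^ 2 * ‖u‖) := by gcongr; exact h u hu (right_ne_zero_of_smul hv0)
    _ = 2 * p ^ 2 * ‖(p : ℤ) • u‖ := by rw [norm_smul, Int.norm_natCast]; ring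

theorem dvd_sub_of_cross_eq_zero (hp : p.Prime) {s' : ℤ}
    (hv : v ∈ (F.shift (p ^ k * s)).lattice p (k + 1))
    (hw : w ∈ (F.shift (p ^ k * s')).lattice p (k + 1)) (hvw : v ⨯₃ w = 0)
    (hvl : ¬ (p : ℤ) ∣ F.lead ⬝ᵥ v) (hwl : ¬ (p : ℤ) ∣ F.lead ⬝ᵥ w) : (p : ℤ) ∣ s - s' := by
  have hpk : (p : ℤ) ^ k ≠ 0 := pow_ne_zero _ (by exact_mod_cast hp.ne_zero)
  have hp' : Prime (p : ℤ) := Nat.prime_iff_prime_int.1 hp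
  have hcomm : F.lead ⬝ᵥ v * F.mid ⬝ᵥ w - F.lead ⬝ᵥ w * F.mid ⬝ᵥ v = 0 := by
    rw [← cross_dot_cross, hvw, dotProduct_zero]
  replace hv := (mem_lattice.1 hv).2
  replace hw := (mem_lattice.1 hw).2
  simp only [shift, add_dotProduct, smul_dotProduct, smul_eq_mul] at hv hw
  have hdvd : (p : ℤ) ^ k * p ∣ p ^ k * ((s - s') * (F.lead ⬝ᵥ v * F.lead ⬝ᵥ w)) := by
    rw [← pow_succ]
    refine ((hv.mul_left (F.lead ⬝ᵥ w)).sub (hw.mul_left (F.lead ⬝ᵥ v))).trans (dvd_of_eq ?_)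
    linear_combination -hcomm
  rw [mul_dvd_mul_iff_left hpk] at hdvd
  exact (hp'.dvd_or_dvd hdvd).resolve_right (hp'.not_dvd_mul hvl hwl)

theorem dvd_sub_of_not_separated_shift (hp : p.Prime) (hdet : IsCoprime (p : ℤ) F.det)
    (hF : F.Separated p k) (hdual : F.dual.Separated p k) {s' : ℤ}
    (hs : ¬ (F.shift (p ^ k * s)).Separated p (k + 1))
    (hs' : ¬ (F.shift (p ^ k * s')).Separated p (k + 1)) : (p : ℤ) ∣ s - s' := by
  have hnot (r : ℤ) {v : Fin 3 → ℤ} (hv : v ∈ (F.shift (p ^ k * r)).lattice p (k + 1))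
      (hv0 : v ≠ 0) (hlt : 2 * p ^ 2 * ‖v‖ < (p : ℝ) ^ (k + 1)) : ¬ (p : ℤ) ∣ F.lead ⬝ᵥ v :=
    (hF.shift (dvd_mul_right _ r)).not_dvd_lead (by rwa [det_shift]) hp.ne_zero hv hv0 hlt
  simp only [Separated, not_forall, not_le] at hs hs'
  obtain ⟨v, hv, hv0, hvlt⟩ := hs
  obtain ⟨w, hw, hw0, hwlt⟩ := hs'
  refine dvd_sub_of_cross_eq_zero hp hv hw ?_ (hnot s hv hv0 hvlt) (hnot s' hw hw0 hwlt)
  by_contra hvw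
  have hle := hdual.sq_le_norm_cross hdet hp.ne_zero
    (lattice_shift_le (dvd_mul_right _ _) k.le_succ hv)
    (lattice_shift_le (dvd_mul_right _ _) k.le_succ hw) hvw
  have hp0 : (0 : ℝ) < p := by exact_mod_cast hp.pos
  have hlt : p ^ 2 * (2 * p ^ 2 * ‖v ⨯₃ w‖) < (p : ℝ) ^ 2 * (p ^ k) ^ 2 :=
    calc p ^ 2 * (2 * p ^ 2 * ‖v ⨯₃ w‖) ≤ p ^ 2 * (2 * p ^ 2 * (2 * ‖v‖ * ‖w‖)) := by
          gcongr; exact norm_cross_le v w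
      _ = (2 * p ^ 2 * ‖v‖) * (2 * p ^ 2 * ‖w‖) := by ring
      _ < p ^ (k + 1) * p ^ (k + 1) := by gcongr
      _ = (p : ℝ) ^ 2 * (p ^ k) ^ 2 := by ring
  exact hlt.not_ge (by gcongr)

theorem exists_separated_shift (hp : p.Prime) (hdet : IsCoprime (p : ℤ) F.det)
    (hF : F.Separated p k) (hdual : F.dual.Separated p k) :
    ∃ s : ℤ, (F.shift (p ^ k * s)).Separated p (k + 1) ∧
      (F.shift (p ^ k * s)).dual.Separated p (k + 1) := by
  have hp2 : 2 < p := by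
    refine hp.two_le.lt_of_ne ?_
    rintro rfl
    exact absurd (Int.isCoprime_iff_gcd_eq_one.1 (isCoprime_two hdet)) (by decide)
  simp only [dual_shift]
  exact exists_and_of_dvd_sub hp2 (fun s s' => dvd_sub_of_not_separated_shift hp hdet hF hdual)
    fun s s' =>
      dvd_sub_of_not_separated_shift hp (isCoprime_det_dual hdet) hdual (hF.dual_dual hdet)

theorem exists_separated (hp : p.Prime) (hdet : IsCoprime (p : ℤ) F.det) (k : ℕ) :
    ∃ t : ℤ, (p : ℤ) ∣ t ∧ (F.shift t).Separated p (k + 1) ∧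
      (F.shift t).dual.Separated p (k + 1) := by
  induction k with
  | zero => exact ⟨0, dvd_zero _, separated_one _ hp.ne_zero, separated_one _ hp.ne_zero⟩
  | succ k ih =>
    obtain ⟨t, hpt, ht, ht'⟩ := ih
    obtain ⟨s, hs⟩ := exists_separated_shift hp (by rwa [det_shift]) ht ht'
    refine ⟨t + p ^ (k + 1) * s, hpt.add ((dvd_pow_self _ k.succ_ne_zero).mul_right s), ?_⟩
    rwa [← shift_shift]

theorem exists_not_dvd_lead_norm_le (hp : p.Prime) (hdet : IsCoprime (p : ℤ) F.det)
    (hF : F.Separated p k) (hdual : F.dual.Separated p k) :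
    ∃ v ∈ F.lattice p k, ‖v‖ ≤ 360 * p ^ 4 * (p : ℝ) ^ k ∧ ¬ (p : ℤ) ∣ F.lead ⬝ᵥ v := by
  obtain ⟨hindex, hle⟩ := index_lattice_ne_zero_and_le F hp.ne_zero k
  have : (F.lattice p k).FiniteIndex := ⟨hindex⟩
  obtain ⟨A, hA, hAL⟩ := exists_det_ne_zero_norm_le (K := 2 * p ^ 2) (pow_pos hp.pos k) hle
    (fun v hv hv0 => by exact_mod_cast hF v hv hv0)
    (fun v hv w hw hvw => by exact_mod_cast hdual.sq_le_norm_cross hdet hp.ne_zero hv hw hvw)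
  have hgen := le_closure_norm_le hA (fun i => (hAL i).1) (fun i => (hAL i).2)
  by_contra! hshort
  have hall : F.lattice p k ≤
      (AddSubgroup.zmultiples (p : ℤ)).comap (dotProductBilin ℤ ℤ F.lead).toAddMonoidHom := by
    refine hgen.trans ((AddSubgroup.closure_le _).2 fun v hv => ?_)
    refine Int.mem_zmultiples_iff.2 (hshort v hv.1 (hv.2.trans_eq ?_))
    rw [Fintype.card_fin]
    push_cast
    ring
  have hmem : F.mid ⨯₃ F.const ∈ F.lattice p k :=
    mem_lattice.2 (by simp [dot_cross_self, dot_self_cross])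
  have hdvd : (p : ℤ) ∣ F.det := (Int.mem_zmultiples_iff.1 (hall hmem)).mul_left 2
  exact (Nat.prime_iff_prime_int.1 hp).not_isUnit (hdet.isUnit_of_dvd' dvd_rfl hdvd)

end QuadCurve

/-- The curve attached to the form `a x² + b y² + c z²` and an isotropic vector `w` modulo `q`. The
coefficient `a` is eliminated through `a * w 0 ^ 2 ≡ -(b * w 1 ^ 2 + c * w 2 ^ 2)`; `const` is
`w 0` times the tangent `(a w₀, b w₁, c w₂)` at `w`. -/
def diagCurve (b c : ℤ) (w : Fin 3 → ℤ) : QuadCurve where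
  lead := (-(b * c)) • ![b * w 1 ^ 2 + c * w 2 ^ 2, b * w 0 * w 1, c * w 0 * w 2]
  mid := (b * c * w 0) • ![0, w 2, -w 1]
  const := ![-(b * w 1 ^ 2 + c * w 2 ^ 2), b * w 0 * w 1, c * w 0 * w 2]

namespace diagCurve

variable {p : ℕ} {a b c m : ℤ} {v w : Fin 3 → ℤ}

theorem det_eq (b c : ℤ) (w : Fin 3 → ℤ) :
    (diagCurve b c w).det = -(2 * (b * c * w 0 * (b * w 1 ^ 2 + c * w 2 ^ 2))) ^ 2 := by
  simp_rw [QuadCurve.det, diagCurve, cross_apply, vec3_dotProduct]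
  simp only [cons_val, Pi.smul_apply, smul_eq_mul]
  ring

theorem lead_dotProduct (b c : ℤ) (v w : Fin 3 → ℤ) : (diagCurve b c w).lead ⬝ᵥ v =
    -(b * c) * ((b * w 1 ^ 2 + c * w 2 ^ 2) * v 0 + w 0 * (b * w 1 * v 1 + c * w 2 * v 2)) := by
  rw [diagCurve, smul_dotProduct, vec3_dotProduct]
  simp only [cons_val, smul_eq_mul]
  ring

theorem mid_dotProduct (b c : ℤ) (v w : Fin 3 → ℤ) :
    (diagCurve b c w).mid ⬝ᵥ v = b * c * w 0 * (w 2 * v 1 - w 1 * v 2) := by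
  rw [diagCurve, smul_dotProduct, vec3_dotProduct]
  simp only [cons_val, smul_eq_mul]
  ring

theorem const_dotProduct (b c : ℤ) (v w : Fin 3 → ℤ) : (diagCurve b c w).const ⬝ᵥ v =
    -(b * w 1 ^ 2 + c * w 2 ^ 2) * v 0 + w 0 * (b * w 1 * v 1 + c * w 2 * v 2) := by
  rw [diagCurve, vec3_dotProduct]
  simp only [cons_val]
  ring

theorem form_eq (b c : ℤ) (v w : Fin 3 → ℤ) :
    (diagCurve b c w).form v = b * c * (b * w 1 ^ 2 + c * w 2 ^ 2) *
      (w 0 ^ 2 * (b * v 1 ^ 2 + c * v 2 ^ 2) - (b * w 1 ^ 2 + c * w 2 ^ 2) * v 0 ^ 2) := by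
  rw [QuadCurve.form, lead_dotProduct, mid_dotProduct, const_dotProduct]
  ring

theorem isCoprime_coeff (habc : IsCoprime m (a * b * c)) (hw₀ : IsCoprime m (w 0))
    (hw : m ∣ a * w 0 ^ 2 + b * w 1 ^ 2 + c * w 2 ^ 2) :
    IsCoprime m (b * c * w 0 * (b * w 1 ^ 2 + c * w 2 ^ 2)) := by
  obtain ⟨k, hk⟩ := hw
  have hd : IsCoprime m (b * w 1 ^ 2 + c * w 2 ^ 2) := by
    have hneg : IsCoprime m (-(a * w 0 ^ 2)) :=
      (habc.of_mul_right_left.of_mul_right_left.mul_right hw₀.pow_right).neg_right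
    have hd : b * w 1 ^ 2 + c * w 2 ^ 2 = -(a * w 0 ^ 2) + m * k := by linear_combination hk
    rw [hd]
    exact hneg.add_mul_left_right k
  exact ((habc.of_mul_right_left.of_mul_right_right.mul_right habc.of_mul_right_right).mul_right
    hw₀).mul_right hd

theorem dvd_of_dvd_form (habc : IsCoprime m (a * b * c)) (hw₀ : IsCoprime m (w 0))
    (hw : m ∣ a * w 0 ^ 2 + b * w 1 ^ 2 + c * w 2 ^ 2) (hv : m ∣ (diagCurve b c w).form v) :
    m ∣ a * v 0 ^ 2 + b * v 1 ^ 2 + c * v 2 ^ 2 := by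
  have hcop := (isCoprime_coeff habc hw₀ hw).mul_right hw₀
  refine hcop.dvd_of_dvd_mul_left ?_
  rw [form_eq] at hv
  refine (hv.add (hw.mul_left (b * c * (b * w 1 ^ 2 + c * w 2 ^ 2) * v 0 ^ 2))).trans
    (dvd_of_eq ?_)
  ring

theorem not_dvd_mul_of_not_dvd_lead (hp : Prime m) (habc : IsCoprime m (a * b * c))
    (hw : m ∣ a * w 0 ^ 2 + b * w 1 ^ 2 + c * w 2 ^ 2) (hw' : IsCoprime m (w 0 * w 1 * w 2))
    (hmid : m ∣ (diagCurve b c w).mid ⬝ᵥ v) (hconst : m ∣ (diagCurve b c w).const ⬝ᵥ v)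
    (hlead : ¬ m ∣ (diagCurve b c w).lead ⬝ᵥ v) : ¬ m ∣ v 0 * v 1 * v 2 := by
  set d := b * w 1 ^ 2 + c * w 2 ^ 2 with hd
  have hcop : IsCoprime m (b * c * w 0 * d) :=
    isCoprime_coeff habc hw'.of_mul_right_left.of_mul_right_left hw
  have hbd : IsCoprime m (b * d) := hcop.of_isCoprime_of_dvd_right ⟨c * w 0, by ring⟩
  have hcd : IsCoprime m (c * d) := hcop.of_isCoprime_of_dvd_right ⟨b * w 0, by ring⟩
  have hlead_eq : (diagCurve b c w).lead ⬝ᵥ v =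
      -(b * c) * (2 * d * v 0 + (diagCurve b c w).const ⬝ᵥ v) := by
    rw [lead_dotProduct, const_dotProduct, hd]; ring
  have hv₁ : b * d * w 1 * v 0 = b * d * w 0 * v 1 - w 2 * ((diagCurve b c w).mid ⬝ᵥ v) -
      b * w 1 * ((diagCurve b c w).const ⬝ᵥ v) := by
    rw [mid_dotProduct, const_dotProduct, hd]; ring
  have hv₂ : c * d * w 2 * v 0 = c * d * w 0 * v 2 + w 1 * ((diagCurve b c w).mid ⬝ᵥ v) -
      c * w 2 * ((diagCurve b c w).const ⬝ᵥ v) := by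
    rw [mid_dotProduct, const_dotProduct, hd]; ring
  have h₀ : ¬ m ∣ v 0 := fun h =>
    hlead (hlead_eq ▸ ((h.mul_left _).add hconst).mul_left _)
  have h₁ : ¬ m ∣ v 1 := fun h => h₀ <| by
    refine (hbd.mul_right hw'.of_mul_right_left.of_mul_right_right).dvd_of_dvd_mul_left (hv₁ ▸ ?_)
    exact ((h.mul_left _).sub (hmid.mul_left _)).sub (hconst.mul_left _)
  have h₂ : ¬ m ∣ v 2 := fun h => h₀ <| by
    refine (hcd.mul_right hw'.of_mul_right_right).dvd_of_dvd_mul_left (hv₂ ▸ ?_)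
    exact ((h.mul_left _).add (hmid.mul_left _)).sub (hconst.mul_left _)
  exact hp.not_dvd_mul (hp.not_dvd_mul h₀ h₁) h₂

end diagCurve

theorem exists_solution_norm_le {p n k : ℕ} (hp : p.Prime) (hp2 : 2 < p) (hn : n ≠ 0)
    (hk : n ≤ 2 * (k + 1)) {a b c : ℤ} (habc : IsCoprime (p : ℤ) (a * b * c)) {w : Fin 3 → ℤ}
    (hw : (p : ℤ) ^ n ∣ a * w 0 ^ 2 + b * w 1 ^ 2 + c * w 2 ^ 2)
    (hw' : ¬ (p : ℤ) ∣ w 0 * w 1 * w 2) :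
    ∃ v : Fin 3 → ℤ, (p : ℤ) ^ n ∣ a * v 0 ^ 2 + b * v 1 ^ 2 + c * v 2 ^ 2 ∧
      ¬ (p : ℤ) ∣ v 0 * v 1 * v 2 ∧ ‖v‖ ≤ 360 * p ^ 4 * (p : ℝ) ^ (k + 1) := by
  have hp' : Prime (p : ℤ) := Nat.prime_iff_prime_int.1 hp
  replace hw' : IsCoprime (p : ℤ) (w 0 * w 1 * w 2) := hp'.coprime_iff_not_dvd.2 hw'
  have hw₀ : IsCoprime (p : ℤ) (w 0) := hw'.of_mul_right_left.of_mul_right_left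
  have hwp := (dvd_pow_self (p : ℤ) hn).trans hw
  have h2 : IsCoprime (p : ℤ) 2 :=
    Nat.isCoprime_iff_coprime.2 ((Nat.coprime_primes hp Nat.prime_two).2 hp2.ne')
  have hdet : IsCoprime (p : ℤ) (diagCurve b c w).det := by
    rw [diagCurve.det_eq]
    exact (h2.mul_right (diagCurve.isCoprime_coeff habc hw₀ hwp)).pow_right.neg_right
  obtain ⟨t, hpt, ht, ht'⟩ := QuadCurve.exists_separated hp hdet k
  obtain ⟨v, hv, hvle, hvlead⟩ :=
    QuadCurve.exists_not_dvd_lead_norm_le hp (by rwa [QuadCurve.det_shift]) ht ht'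
  have hform : (p : ℤ) ^ n ∣ (diagCurve b c w).form v := by
    rw [← QuadCurve.form_shift _ t]
    exact (pow_dvd_pow _ hk).trans (QuadCurve.pow_dvd_form hv)
  have hv₁ : v ∈ (diagCurve b c w).lattice p 1 :=
    QuadCurve.lattice_shift_le (by rwa [pow_one]) k.succ_pos hv
  rw [QuadCurve.mem_lattice, pow_one] at hv₁
  refine ⟨v, diagCurve.dvd_of_dvd_form habc.pow_left hw₀.pow_left hw hform, ?_, hvle⟩
  exact diagCurve.not_dvd_mul_of_not_dvd_lead hp' habc hwp hw' hv₁.2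
    ((dvd_pow_self _ two_ne_zero).trans hv₁.1) hvlead

theorem minHeight_le_norm {p n : ℕ} {a b c : ℤ} {v : Fin 3 → ℤ}
    (hv : (p : ℤ) ^ n ∣ a * v 0 ^ 2 + b * v 1 ^ 2 + c * v 2 ^ 2)
    (hv' : ¬ (p : ℤ) ∣ v 0 * v 1 * v 2) : (minHeight p n a b c : ℝ) ≤ ‖v‖ := by
  have hle : minHeight p n a b c ≤ max (v 0).natAbs (max (v 1).natAbs (v 2).natAbs) :=
    Nat.sInf_le ⟨v 0, v 1, v 2, Int.modEq_zero_iff_dvd.2 hv, hv', rfl⟩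
  have hnorm (i : Fin 3) : ((v i).natAbs : ℝ) ≤ ‖v‖ := by
    rw [Nat.cast_natAbs, Int.cast_abs, ← Int.norm_eq_abs]
    exact norm_le_pi_norm v i
  refine (Nat.cast_le.2 hle).trans ?_
  rw [Nat.cast_max, Nat.cast_max]
  exact max_le (hnorm 0) (max_le (hnorm 1) (hnorm 2))

theorem pow_half_le_sqrt_pow {x : ℝ} (hx : 1 ≤ x) (n : ℕ) : x ^ (n / 2) ≤ √(x ^ n) := by
  refine Real.le_sqrt_of_sq_le ?_
  rw [← pow_mul]
  exact pow_le_pow_right₀ hx (Nat.div_mul_le_self n 2)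

theorem minHeight_le_sqrt {p : ℕ} (hp : p.Prime) (hp2 : 2 < p) (n : ℕ) {α₁ α₂ α₃ : ℤ}
    (h : IsCoprime (α₁ * α₂ * α₃) (p : ℤ)) :
    (minHeight p n α₁ α₂ α₃ : ℝ) ≤ 360 * p ^ 5 * √((p : ℝ) ^ n) := by
  have hp1 : (1 : ℝ) ≤ p := by exact_mod_cast hp.one_le
  obtain hempty | ⟨-, x₁, x₂, x₃, hx, hx', -⟩ := (solutionHeights p n α₁ α₂ α₃).eq_empty_or_nonempty
  · rw [minHeight_eq_zero hempty, Nat.cast_zero]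
    positivity
  obtain rfl | hn := eq_or_ne n 0
  · have hone := minHeight_le_norm (p := p) (n := 0) (a := α₁) (b := α₂) (c := α₃) (v := 1)
      (by simp) (by simpa using (Nat.prime_iff_prime_int.1 hp).not_dvd_one)
    rw [pow_zero, Real.sqrt_one, mul_one]
    refine hone.trans ?_
    rw [norm_one]
    nlinarith [one_le_pow₀ hp1 (n := 5)]
  obtain ⟨v, hv, hv', hvle⟩ := exists_solution_norm_le (k := n / 2) (w := ![x₁, x₂, x₃]) hp hp2 hn
    (by lia) h.symm (Int.modEq_zero_iff_dvd.1 hx) hx'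
  calc (minHeight p n α₁ α₂ α₃ : ℝ) ≤ ‖v‖ := minHeight_le_norm hv hv'
    _ ≤ 360 * p ^ 4 * (p : ℝ) ^ (n / 2 + 1) := hvle
    _ = 360 * p ^ 5 * (p : ℝ) ^ (n / 2) := by ring
    _ ≤ 360 * p ^ 5 * √((p : ℝ) ^ n) := by gcongr; exact pow_half_le_sqrt_pow hp1 n

theorem corollary3_general (p : ℕ) (hp : p.Prime) (hp2 : 2 < p) (r : ℝ) (hr : 1 / 2 ≤ r) :
    ∃ C : ℝ, 0 < C ∧ ∀ n : ℕ, ∀ α₁ α₂ α₃ : ℤ, IsCoprime (α₁ * α₂ * α₃) (p : ℤ) →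
      (minHeight p n α₁ α₂ α₃ : ℝ) ≤ C * ((p : ℝ) ^ n) ^ r := by
  have hp1 : (1 : ℝ) ≤ p := by exact_mod_cast hp.one_le
  refine ⟨360 * p ^ 5, by positivity, fun n α₁ α₂ α₃ h => (minHeight_le_sqrt hp hp2 n h).trans ?_⟩
  rw [Real.sqrt_eq_rpow]
  gcongr
  exact one_le_pow₀ hp1

theorem corollary3 (p : ℕ) (hp : p.Prime) (hp2 : 2 < p) (ε : ℝ) (hε : 0 < ε) :
    (∀ α₁ α₂ α₃ : ℤ, IsCoprime (α₁ * α₂ * α₃) (p : ℤ) →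
      ∃ C : ℝ, 0 < C ∧ ∀ n : ℕ,
        (minHeight p n α₁ α₂ α₃ : ℝ) ≤ C * ((p : ℝ) ^ n) ^ ((1 : ℝ) / 2 + ε)) ∧
    (∃ C : ℝ, 0 < C ∧ ∀ n : ℕ, ∀ α₁ α₂ α₃ : ℤ, IsCoprime (α₁ * α₂ * α₃) (p : ℤ) →
        (minHeight p n α₁ α₂ α₃ : ℝ) ≤ C * ((p : ℝ) ^ n) ^ ((11 : ℝ) / 18 + ε)) := by
  obtain ⟨C, hC, hle⟩ := corollary3_general p hp hp2 (1 / 2 + ε) (by linarith)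
  exact ⟨fun α₁ α₂ α₃ h => ⟨C, hC, fun n => hle n α₁ α₂ α₃ h⟩,
    corollary3_general p hp hp2 (11 / 18 + ε) (by linarith)⟩
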